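/- Let $R$ be a locally compact Hausdorff topological ring (unital, not necessarily commutative), and let $X$ be a $k$-space, i.e. a topological space in which a subset $A$ is closed whenever $A\cap K$ is closed in $K$ for every compact $K\subseteq X$. A semitopological (respectively, topological) $R$-module is a unital left $R$-module $M$ with a Hausdorff topology making $M$ a topological abelian group and making the multiplication $R\times M\to M$ separately (respectively, jointly) continuous. A free semitopological (respectively, free topological) $R$-module over $X$ is a pair $(M,i)$ consisting of a semitopological (respectively, topological) $R$-module $M$ and a continuous map $i:X\to M$ such that for every continuous map $f:X\to Y$ to a semitopological (respectively, topological) $R$-module $Y$ there is a unique continuous $R$-linear map $\bar f:M\to Y$ with $f=\bar f\circ i$. Then a free semitopological $R$-module over $X$ exists, and every free semitopological $R$-module $(M_R(X),i_X)$ over $X$ is such that $M_R(X)$ is a topological $R$-module and $(M_R(X),i_X)$ is a free topological $R$-module over $X$. -/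

import Mathlib

universe u v w

/-- A semitopological module over a topological ring `R`: a (left, unital) `R`-module with a
Hausdorff topology that makes it a topological abelian group and makes the scalar multiplication
`R × M → M` separately continuous. -/
structure IsSemitopologicalModule (R : Type u) (M : Type w) [Ring R] [TopologicalSpace R]
    [AddCommGroup M] [Module R M] [TopologicalSpace M] : Prop where
  t2Space : T2Space M
  isTopologicalAddGroup : IsTopologicalAddGroup M
  continuous_smul_left : ∀ x : M, Continuous fun r : R => r • x
  continuous_smul_right : ∀ r : R, Continuous fun x : M => r • x

/-- A topological module over a topological ring `R`: a (left, unital) `R`-module with a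
Hausdorff topology that makes it a topological abelian group and makes the scalar multiplication
`R × M → M` jointly continuous. -/
structure IsHausdorffTopologicalModule (R : Type u) (M : Type w) [Ring R] [TopologicalSpace R]
    [AddCommGroup M] [Module R M] [TopologicalSpace M] : Prop where
  t2Space : T2Space M
  isTopologicalAddGroup : IsTopologicalAddGroup M
  continuous_smul : Continuous fun p : R × M => p.1 • p.2

/-- `(M, i)` is a free semitopological `R`-module over the topological space `X`. The test modules
range over a universe that contains those of `R`, `X` and `M`; no larger universe is needed, as the
submodule generated by the image of `X` in any module has a copy in that universe. -/
structure IsFreeSemitopologicalModule (R : Type u) (X : Type v) (M : Type w)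
    [Ring R] [TopologicalSpace R] [TopologicalSpace X]
    [AddCommGroup M] [Module R M] [TopologicalSpace M] (i : X → M) : Prop where
  isSemitopologicalModule : IsSemitopologicalModule R M
  continuous_map : Continuous i
  existsUnique_lift : ∀ (Y : Type (max u v w)) [AddCommGroup Y] [Module R Y] [TopologicalSpace Y],
    IsSemitopologicalModule R Y → ∀ f : X → Y, Continuous f →
      ∃! g : M →L[R] Y, f = g ∘ i

/-- `(M, i)` is a free topological `R`-module over the topological space `X`: the same universal
property, with topological modules in place of semitopological ones. -/
structure IsFreeTopologicalModule (R : Type u) (X : Type v) (M : Type w)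
    [Ring R] [TopologicalSpace R] [TopologicalSpace X]
    [AddCommGroup M] [Module R M] [TopologicalSpace M] (i : X → M) : Prop where
  isHausdorffTopologicalModule : IsHausdorffTopologicalModule R M
  continuous_map : Continuous i
  existsUnique_lift : ∀ (Y : Type (max u v w)) [AddCommGroup Y] [Module R Y] [TopologicalSpace Y],
    IsHausdorffTopologicalModule R Y → ∀ f : X → Y, Continuous f →
      ∃! g : M →L[R] Y, f = g ∘ i

/-! Retopologize a free semitopological module `M` by embedding it in `C(R, M)` through `m ↦ (r ↦ r
• m)`, with the compact-open topology. This gives a finer semitopological module `OrbitModule`. If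
`X → OrbitModule` is continuous, freeness makes the identity `M → OrbitModule` continuous, and local
compactness of `R` turns this into joint continuity of `R × M → M`. Topological modules being
semitopological, the universal property then restricts to them. Continuity of `X → OrbitModule` need
only be checked on compact `K ⊆ X`, where `continuous_of_separately_continuous` upgrades separate
continuity of `(x, r) ↦ r • i x` to joint continuity. -/

open Filter Topology

/-! ### Separate versus joint continuity -/

section SeparateContinuity

variable {G K M : Type*} [AddCommGroup G] [TopologicalSpace G] [IsTopologicalAddGroup G]
  [WeaklyLocallyCompactSpace G] [TopologicalSpace K] [CompactSpace K]
  [AddCommGroup M] [TopologicalSpace M] [IsTopologicalAddGroup M]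

/-- Gliding hump: a failure of convergence would produce a sequence `y` in `K` and a series in `G`
with partial sums `s` for which the limits of `f (y m) (s n)` cannot be interchanged. -/
theorem tendsto_zero_of_separately_continuous (f : K → G →+ M) (hG : ∀ x, Continuous (f x))
    (hK : ∀ g, Continuous fun x => f x g) (x₀ : K) (hx₀ : ∀ g, f x₀ g = 0) :
    Tendsto (fun p : G × K => f p.2 p.1) (𝓝 0 ×ˢ 𝓝 x₀) (𝓝 0) := by
  intro W hW
  by_contra hfail
  have hpick : ∀ U ∈ 𝓝 (0 : G), ∀ B ∈ 𝓝 x₀, ∃ g ∈ U, ∃ x ∈ B, f x g ∉ W := by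
    intro U hU B hB
    by_contra! hcon
    exact hfail (mem_map.2 (mem_of_superset (prod_mem_prod hU hB) fun p hp => hcon _ hp.1 _ hp.2))
  obtain ⟨N, hN, hNc, hNW⟩ : ∃ N ∈ 𝓝 (0 : M), IsClosed N ∧
      ∀ a ∈ N, ∀ b ∈ N, ∀ c ∈ N, ∀ d ∈ N, a + b - c - d ∈ W := by
    have hc : Continuous fun q : (M × M) × (M × M) => q.1.1 + q.1.2 - q.2.1 - q.2.2 := by fun_prop
    have h0 : (fun q : (M × M) × (M × M) => q.1.1 + q.1.2 - q.2.1 - q.2.2) ⁻¹' W ∈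
        𝓝 (((0, 0), (0, 0)) : (M × M) × (M × M)) :=
      hc.continuousAt.preimage_mem_nhds (by simpa using hW)
    rw [nhds_prod_eq, nhds_prod_eq] at h0
    obtain ⟨A, hA, hA'⟩ := mem_prod_same_iff.1 h0
    obtain ⟨B, hB, hB'⟩ := mem_prod_same_iff.1 hA
    obtain ⟨N, hN, hNc, hNB⟩ := exists_mem_nhds_isClosed_subset hB
    refine ⟨N, hN, hNc, fun a ha b hb c hc d hd => ?_⟩
    exact @hA' ((a, b), (c, d)) ⟨hB' ⟨hNB ha, hNB hb⟩, hB' ⟨hNB hc, hNB hd⟩⟩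
  have h0N : (0 : M) ∈ interior N := mem_interior_iff_mem_nhds.2 hN
  obtain ⟨C, hC, hC0⟩ := exists_compact_mem_nhds (0 : G)
  -- A partial sum, an open set confining it and all later partial sums, and a neighbourhood of `x₀`
  -- confining all later points of `K`.
  let State := {p : G × Set G × Set K // p.1 ∈ p.2.1 ∧ IsOpen p.2.1 ∧ IsOpen p.2.2 ∧ x₀ ∈ p.2.2}
  have hstep : ∀ p : State, ∃ q : State, ∃ y : K, f y (q.1.1 - p.1.1) ∉ W ∧ y ∈ p.1.2.2 ∧
      q.1.2.1 ⊆ p.1.2.1 ∧ q.1.2.2 ⊆ p.1.2.2 ∧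
      (∀ t ∈ q.1.2.1, f y (t - q.1.1) ∈ interior N) ∧
      ∀ x ∈ q.1.2.2, f x q.1.1 ∈ interior N := by
    rintro ⟨⟨s, O, B⟩, hs, hO, hB, hxB⟩
    dsimp only at hs hO hB hxB
    obtain ⟨g, hg, y, hy, hgy⟩ := hpick ((fun g => s + g) ⁻¹' O)
      ((by fun_prop : Continuous fun g => s + g).continuousAt.preimage_mem_nhds
        (by simpa using hO.mem_nhds hs)) B (hB.mem_nhds hxB)
    refine ⟨⟨(s + g, O ∩ (fun t => f y (t - (s + g))) ⁻¹' interior N,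
      B ∩ (fun x => f x (s + g)) ⁻¹' interior N), ⟨hg, ?_⟩, ?_, ?_, hxB, ?_⟩, y, ?_, hy,
      Set.inter_subset_left, Set.inter_subset_left, fun t ht => ht.2, fun x hx => hx.2⟩
    · simpa using h0N
    · exact hO.inter (isOpen_interior.preimage ((hG y).comp (by fun_prop)))
    · exact hB.inter (isOpen_interior.preimage (hK _))
    · simpa [hx₀] using h0N
    · simpa using hgy
  choose next pt hpt using hstep
  let st : ℕ → State := fun n => next^[n]
    ⟨(0, interior C, Set.univ), mem_interior_iff_mem_nhds.2 hC0, isOpen_interior, isOpen_univ,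
      trivial⟩
  have hst : ∀ n, st (n + 1) = next (st n) := fun n => Function.iterate_succ_apply' _ _ _
  let s : ℕ → G := fun n => (st n).1.1
  let y : ℕ → K := fun n => pt (st n)
  have hOanti : Antitone fun n => (st n).1.2.1 :=
    antitone_nat_of_succ_le fun n => by rw [hst]; exact (hpt (st n)).2.2.1
  have hBanti : Antitone fun n => (st n).1.2.2 :=
    antitone_nat_of_succ_le fun n => by rw [hst]; exact (hpt (st n)).2.2.2.1
  have hW' : ∀ n, f (y n) (s (n + 1) - s n) ∉ W := fun n => by
    simp only [s, hst]; exact (hpt (st n)).1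
  have hsC : ∀ n, s n ∈ C := fun n => interior_subset (hOanti (Nat.zero_le n) (st n).2.1)
  have htail : ∀ n m, n + 1 ≤ m → f (y n) (s m - s (n + 1)) ∈ N := fun n m hnm => by
    have h := hOanti hnm (st m).2.1
    simp only [s, hst n] at h ⊢
    exact interior_subset ((hpt (st n)).2.2.2.2.1 _ h)
  have hhead : ∀ n m, n ≤ m → f (y m) (s n) ∈ N := fun n m hnm => by
    have h := hBanti hnm (hpt (st m)).2.1
    cases n with
    | zero => simpa [s, st] using interior_subset h0N
    | succ n =>
      simp only [s, hst n] at h ⊢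
      exact interior_subset ((hpt (st n)).2.2.2.2.2 _ h)
  -- The cluster points of `s` and `y` are chosen independently; no common subsequence is needed,
  -- since membership in the closed set `N` passes to each in turn.
  obtain ⟨h, -, hh⟩ := hC.exists_mapClusterPt_of_frequently (l := atTop) (f := s)
    (Eventually.of_forall hsC).frequently
  obtain ⟨x, -, hx⟩ := isCompact_univ.exists_mapClusterPt_of_frequently (l := atTop) (f := y)
    (Eventually.of_forall fun _ => Set.mem_univ _).frequently
  have hxs : ∀ n, f x (s n) ∈ N := fun n =>
    (hNc.preimage (hK (s n))).mem_of_mapClusterPt hx (eventually_atTop.2 ⟨n, hhead n⟩)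
  have hxh : f x h ∈ N :=
    (hNc.preimage (hG x)).mem_of_mapClusterPt hh (Eventually.of_forall hxs)
  have hyh : ∀ n, f (y n) (h - s (n + 1)) ∈ N := fun n =>
    (hNc.preimage (show Continuous fun t => f (y n) (t - s (n + 1)) from
      (hG (y n)).comp (by fun_prop))).mem_of_mapClusterPt hh (eventually_atTop.2 ⟨n + 1, htail n⟩)
  have hclose : {z : K | f z h - f x h ∈ N} ∈ 𝓝 x :=
    ((hK h).sub continuous_const).continuousAt.preimage_mem_nhds (by simpa using hN)
  obtain ⟨m, hm⟩ := (hx.frequently hclose).exists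
  apply hW' m
  -- `f (y m) (s (m + 1) - s m)` equals `(f (y m) h - f x h) + f x h - f (y m) (h - s (m + 1)) - f
  -- (y m) (s m)`.
  have key := hNW _ hm _ hxh _ (hyh m) _ (hhead m m le_rfl)
  convert key using 1
  simp only [map_sub]
  abel

/-- Near `(x₀, g₀)`, write `f x g = (f x - f x₀) (g - g₀) + f x₀ (g - g₀) + f x g₀`; only the first
term needs the gliding hump. -/
theorem continuous_of_separately_continuous (f : K → G →+ M) (hG : ∀ x, Continuous (f x))
    (hK : ∀ g, Continuous fun x => f x g) : Continuous fun p : K × G => f p.1 p.2 := by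
  rw [continuous_iff_continuousAt]
  rintro ⟨x₀, g₀⟩
  have h := tendsto_zero_of_separately_continuous (fun x => f x - f x₀)
    (fun x => (hG x).sub (hG x₀)) (fun g => (hK g).sub continuous_const) x₀ (by simp)
  have hmap : Tendsto (fun p : K × G => (p.2 - g₀, p.1)) (𝓝 (x₀, g₀)) (𝓝 0 ×ˢ 𝓝 x₀) := by
    rw [← nhds_prod_eq]
    have : Continuous fun p : K × G => (p.2 - g₀, p.1) := by fun_prop
    simpa using this.tendsto (x₀, g₀)
  have h₁ : Tendsto (fun p : K × G => f p.1 g₀) (𝓝 (x₀, g₀)) (𝓝 (f x₀ g₀)) :=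
    ((hK g₀).comp continuous_fst).tendsto (x₀, g₀)
  have h₂ : Tendsto (fun p : K × G => f x₀ (p.2 - g₀)) (𝓝 (x₀, g₀)) (𝓝 0) := by
    have : Continuous fun p : K × G => f x₀ (p.2 - g₀) := (hG x₀).comp (by fun_prop)
    simpa using this.tendsto (x₀, g₀)
  have h₃ := ((h.comp hmap).add h₂).add h₁
  simp only [zero_add] at h₃
  refine h₃.congr fun p => ?_
  simp

end SeparateContinuity

/-- For a locally compact ring, the orbit map of a continuous map from a compactly coherent space
into a semitopological module is continuous for the compact-open topology. -/
theorem continuous_orbitMap {R X M : Type*} [Ring R] [TopologicalSpace R] [IsTopologicalRing R]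
    [LocallyCompactSpace R] [TopologicalSpace X] [CompactlyCoherentSpace X] [AddCommGroup M]
    [Module R M] [TopologicalSpace M] (hM : IsSemitopologicalModule R M) {i : X → M}
    (hi : Continuous i) :
    Continuous fun x => (⟨fun r : R => r • i x, hM.continuous_smul_left (i x)⟩ : C(R, M)) := by
  have := hM.isTopologicalAddGroup
  rw [CompactlyCoherentSpace.isCoherentWith.continuous_iff]
  intro K hK
  have : CompactSpace K := isCompact_iff_compactSpace.1 hK
  rw [continuousOn_iff_continuous_domRestrict]
  refine ContinuousMap.continuous_of_continuous_uncurry _ ?_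
  exact continuous_of_separately_continuous
    (fun x : K => ((LinearMap.toSpanSingleton R M (i x)).toAddMonoidHom : R →+ M))
    (fun x => hM.continuous_smul_left (i x))
    (fun r => (hM.continuous_smul_right r).comp (hi.comp continuous_subtype_val))

/-! ### The compact-open retopologization -/

section OrbitModule

variable {R : Type u} {M : Type w} [Ring R] [TopologicalSpace R] [AddCommGroup M] [Module R M]
  [TopologicalSpace M]

/-- The orbit map of an element of a semitopological module. -/
def orbitMap (hM : IsSemitopologicalModule R M) (m : M) : C(R, M) :=
  ⟨fun r => r • m, hM.continuous_smul_left m⟩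

/-- A copy of a semitopological module, to be given the topology induced by the compact-open
topology on orbit maps. -/
def OrbitModule (_ : IsSemitopologicalModule R M) : Type w := M

namespace OrbitModule

variable (hM : IsSemitopologicalModule R M)

instance : AddCommGroup (OrbitModule hM) := inferInstanceAs (AddCommGroup M)

instance : Module R (OrbitModule hM) := inferInstanceAs (Module R M)

/-- The identity map from the copy back to the module. -/
def equiv : OrbitModule hM ≃ₗ[R] M := LinearEquiv.refl R M

instance : TopologicalSpace (OrbitModule hM) :=
  .induced (fun m => orbitMap hM (equiv hM m)) inferInstance

theorem continuous_orbitMap_equiv : Continuous fun m => orbitMap hM (equiv hM m) :=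
  continuous_induced_dom

theorem continuous_equiv : Continuous (equiv hM) := by
  have h : Continuous fun m => orbitMap hM (equiv hM m) 1 :=
    (continuous_eval_const (1 : R)).comp (continuous_orbitMap_equiv hM)
  simpa [orbitMap] using h

theorem isSemitopologicalModule [IsTopologicalRing R] :
    IsSemitopologicalModule R (OrbitModule hM) := by
  have := hM.isTopologicalAddGroup
  have := hM.t2Space
  let φ : OrbitModule hM →+ C(R, M) :=
    { toFun := fun m => orbitMap hM (equiv hM m)
      map_zero' := by ext; simp [orbitMap]
      map_add' := fun x y => by ext; simp [orbitMap] }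
  refine ⟨.of_injective_continuous (equiv hM).injective (continuous_equiv hM),
    topologicalAddGroup_induced φ, fun m => ?_, fun r => ?_⟩
  · refine continuous_induced_rng.2 (ContinuousMap.continuous_of_continuous_uncurry _ ?_)
    have : Continuous fun p : R × R => orbitMap hM (equiv hM m) (p.2 * p.1) := by fun_prop
    simpa [orbitMap, Function.uncurry_def, mul_smul] using this
  · refine continuous_induced_rng.2 ?_
    have h : Continuous fun m =>
        (orbitMap hM (equiv hM m)).comp ⟨fun s : R => s * r, by fun_prop⟩ :=
      (ContinuousMap.continuous_precomp _).comp (continuous_orbitMap_equiv hM)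
    -- The orbit map of `r • m` is that of `m` precomposed with right multiplication by `r`.
    convert h using 2 with m
    ext s
    simp [orbitMap, mul_smul]

end OrbitModule

end OrbitModule

theorem IsSemitopologicalModule.ulift {R : Type u} {M : Type w} [Ring R] [TopologicalSpace R]
    [AddCommGroup M] [Module R M] [TopologicalSpace M] (hM : IsSemitopologicalModule R M) :
    IsSemitopologicalModule R (ULift.{v} M) := by
  have := hM.isTopologicalAddGroup
  have := hM.t2Space
  exact ⟨inferInstance,
    { continuous_add := continuous_uliftUp.comp <| continuous_add.comp <|
        continuous_uliftDown.prodMap continuous_uliftDown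
      continuous_neg := continuous_uliftUp.comp <| continuous_neg.comp continuous_uliftDown },
    fun x => continuous_uliftUp.comp (hM.continuous_smul_left x.down),
    fun r => continuous_uliftUp.comp ((hM.continuous_smul_right r).comp continuous_uliftDown)⟩

theorem IsHausdorffTopologicalModule.isSemitopologicalModule {R : Type u} {M : Type w} [Ring R]
    [TopologicalSpace R] [AddCommGroup M] [Module R M] [TopologicalSpace M]
    (hM : IsHausdorffTopologicalModule R M) : IsSemitopologicalModule R M where
  t2Space := hM.t2Space
  isTopologicalAddGroup := hM.isTopologicalAddGroup
  continuous_smul_left m := hM.continuous_smul.comp (by fun_prop : Continuous fun r : R => (r, m))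
  continuous_smul_right r := hM.continuous_smul.comp (by fun_prop : Continuous fun m : M => (r, m))

/-- `OrbitModule` lives in the universe of `M`, so the universal property reaches it through
`ULift`. -/
theorem IsFreeSemitopologicalModule.existsUnique_lift_of_small {R : Type u} {X : Type v}
    {M : Type w} [Ring R] [TopologicalSpace R] [TopologicalSpace X] [AddCommGroup M] [Module R M]
    [TopologicalSpace M] {i : X → M} (h : IsFreeSemitopologicalModule R X M i)
    {Y : Type w} [AddCommGroup Y] [Module R Y] [TopologicalSpace Y]
    (hY : IsSemitopologicalModule R Y) {f : X → Y} (hf : Continuous f) :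
    ∃! g : M →L[R] Y, f = g ∘ i := by
  let e : ULift.{max u v w} Y ≃L[R] Y := ContinuousLinearEquiv.ulift
  obtain ⟨g, hg, hg'⟩ := h.existsUnique_lift (ULift.{max u v w} Y) hY.ulift (ULift.up ∘ f)
    (continuous_uliftUp.comp hf)
  refine ⟨(e : ULift.{max u v w} Y →L[R] Y).comp g, ?_, fun k hk => ?_⟩
  · funext x
    exact congrArg ULift.down (congrFun hg x)
  · rw [← hg' ((e.symm : Y →L[R] ULift.{max u v w} Y).comp k)]
    · ext; simp
    · subst hk; rfl

theorem IsFreeSemitopologicalModule.isHausdorffTopologicalModule {R : Type u} {X : Type v}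
    {M : Type w} [Ring R] [TopologicalSpace R] [IsTopologicalRing R] [LocallyCompactSpace R]
    [TopologicalSpace X] [CompactlyCoherentSpace X] [AddCommGroup M] [Module R M]
    [TopologicalSpace M] {i : X → M} (h : IsFreeSemitopologicalModule R X M i) :
    IsHausdorffTopologicalModule R M := by
  have hM := h.isSemitopologicalModule
  have hc : Continuous (orbitMap hM) := by
    obtain ⟨g, hg, -⟩ := h.existsUnique_lift_of_small (OrbitModule.isSemitopologicalModule hM)
      (f := (OrbitModule.equiv hM).symm ∘ i)
      (continuous_induced_rng.2 (continuous_orbitMap hM h.continuous_map))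
    let e : OrbitModule hM →L[R] M := ⟨(OrbitModule.equiv hM).toLinearMap,
      OrbitModule.continuous_equiv hM⟩
    -- Both sides extend `i`, so `g` is the identity map into the finer topology.
    have he : e.comp g = ContinuousLinearMap.id R M :=
      (h.existsUnique_lift_of_small hM h.continuous_map).unique
        (funext fun x => congrArg (OrbitModule.equiv hM) (congrFun hg x)) rfl
    refine ((OrbitModule.continuous_orbitMap_equiv hM).comp g.continuous).congr fun m => ?_
    exact congrArg (orbitMap hM) (DFunLike.congr_fun he m)
  refine ⟨hM.t2Space, hM.isTopologicalAddGroup, ?_⟩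
  have := ContinuousMap.continuous_uncurry_of_continuous ⟨_, hc⟩
  exact this.comp continuous_swap

/-! ### Construction of the free module -/

section Existence

variable (R : Type u) [Ring R] [TopologicalSpace R] (X : Type v) [TopologicalSpace X]

/-- The group topologies on the free module over `X` with separately continuous scalar
multiplication for which the insertion of generators is continuous. -/
def semitopologicalModuleTopologies : Set (TopologicalSpace (X →₀ R)) :=
  {t | @IsTopologicalAddGroup _ t _ ∧ (∀ m : X →₀ R, Continuous[_, t] fun r : R => r • m) ∧
    (∀ r : R, Continuous[t, t] fun m => r • m) ∧ Continuous[_, t] fun x => Finsupp.single x (1 : R)}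

-- Makes the linear extension of `f` continuous for the infimum of these topologies.
variable {R X} in
theorem induced_mem_semitopologicalModuleTopologies {Y : Type*} [AddCommGroup Y] [Module R Y]
    [TopologicalSpace Y] (hY : IsSemitopologicalModule R Y) {f : X → Y} (hf : Continuous f) :
    TopologicalSpace.induced (Finsupp.linearCombination R f) ‹_› ∈
      semitopologicalModuleTopologies R X := by
  let := TopologicalSpace.induced (Finsupp.linearCombination R f) ‹_›
  have := hY.isTopologicalAddGroup
  refine ⟨topologicalAddGroup_induced _, fun m => continuous_induced_rng.2 ?_,
    fun r => continuous_induced_rng.2 ?_, continuous_induced_rng.2 ?_⟩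
  · simpa [Function.comp_def] using hY.continuous_smul_left (Finsupp.linearCombination R f m)
  · simpa [Function.comp_def] using (hY.continuous_smul_right r).comp continuous_induced_dom
  · simpa [Function.comp_def] using hf

theorem exists_isFreeSemitopologicalModule :
    ∃ (M : Type (max u v)) (_ : AddCommGroup M) (_ : Module R M) (_ : TopologicalSpace M)
      (i : X → M), IsFreeSemitopologicalModule R X M i := by
  -- In Mathlib's order this is the coarsest topology finer than every member. It may fail to be
  -- Hausdorff, hence the separation quotient below.
  let t : TopologicalSpace (X →₀ R) := sInf (semitopologicalModuleTopologies R X)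
  have hgrp : IsTopologicalAddGroup (X →₀ R) := topologicalAddGroup_sInf fun _ h => h.1
  have hsmul : ContinuousConstSMul R (X →₀ R) := ⟨fun r =>
    continuous_sInf_rng.2 fun _ h => continuous_sInf_dom h (h.2.2.1 r)⟩
  have hleft : ∀ m : X →₀ R, Continuous fun r : R => r • m := fun m =>
    continuous_sInf_rng.2 fun _ h => h.2.1 m
  have hsingle : Continuous fun x : X => Finsupp.single x (1 : R) :=
    continuous_sInf_rng.2 fun _ h => h.2.2.2
  refine ⟨SeparationQuotient (X →₀ R), inferInstance, inferInstance, inferInstance,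
    fun x => SeparationQuotient.mk (Finsupp.single x 1), ⟨inferInstance, inferInstance, ?_, ?_⟩,
    SeparationQuotient.continuous_mk.comp hsingle, ?_⟩
  · intro m
    obtain ⟨m, rfl⟩ := SeparationQuotient.surjective_mk m
    exact SeparationQuotient.continuous_mk.comp (hleft m)
  · exact fun r => continuous_const_smul r
  · intro Y _ _ _ hY f hf
    have := hY.t2Space
    let F : (X →₀ R) →L[R] Y := ⟨Finsupp.linearCombination R f,
      continuous_sInf_dom (induced_mem_semitopologicalModuleTopologies hY hf)
        continuous_induced_dom⟩
    refine ⟨SeparationQuotient.liftCLM F fun x y hxy => (hxy.map F.continuous).eq, ?_, ?_⟩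
    · funext x
      simp [F]
    · intro g hg
      ext m
      obtain ⟨m, rfl⟩ := SeparationQuotient.surjective_mk m
      have : g.toLinearMap ∘ₗ (SeparationQuotient.mkCLM R (X →₀ R)).toLinearMap =
          Finsupp.linearCombination R f := by
        ext x
        simp [hg]
      exact LinearMap.congr_fun this m

end Existence

theorem theorem6p2 (R : Type u) [Ring R] [TopologicalSpace R] [IsTopologicalRing R] [T2Space R]
    [LocallyCompactSpace R] (X : Type v) [TopologicalSpace X] [CompactlyCoherentSpace X] :
    (∃ (M : Type (max u v)) (_ : AddCommGroup M) (_ : Module R M) (_ : TopologicalSpace M)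
      (i : X → M), IsFreeSemitopologicalModule R X M i) ∧
    ∀ (M : Type w) [AddCommGroup M] [Module R M] [TopologicalSpace M] (i : X → M),
      IsFreeSemitopologicalModule R X M i →
        IsHausdorffTopologicalModule R M ∧ IsFreeTopologicalModule R X M i := by
  refine ⟨exists_isFreeSemitopologicalModule R X, fun M _ _ _ i h => ?_⟩
  have hM := h.isHausdorffTopologicalModule
  exact ⟨hM, hM, h.continuous_map,
    fun Y _ _ _ hY f hf => h.existsUnique_lift Y hY.isSemitopologicalModule f hf⟩
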